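/- Let $G$ be a torsion $2$-group, that is, a group in which every element has finite order equal to a power of $2$. Suppose that for some field $k$ of characteristic $2$ the group algebra $kG$ is noetherian. Then $G$ is finite. (Since $g\mapsto g^{-1}$ induces an isomorphism of $kG$ with its opposite ring, $kG$ is left noetherian if and only if it is right noetherian, so it does not matter on which side the condition is imposed.) -/

import Mathlib

/-!
The noetherian condition on `k[G]` gives the ascending chain condition on subgroups of `G`, and a
`2`-group with this condition is finite.

*From the group algebra to the group.* To a subgroup `H` attach the left ideal of `k[G]` generated
by the elements `h - 1` with `h ∈ H`. It annihilates the base point of the permutation module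
`k[G ⧸ H]`, while `g - 1` does not unless `g ∈ H`. So `H` can be recovered from its ideal, and the
subgroups of `G` embed, as an ordered set, into the left ideals of `k[G]`
(`wellFoundedGT_subgroup_of_isNoetherianRing`).

*A `2`-group with the ascending chain condition on subgroups is finite*
(`finite_of_isPGroup_two_of_wellFoundedGT`). Every finite subgroup lies in a maximal finite one.
Suppose `A ≠ B` are maximal finite subgroups whose intersection `D` is as large as possible. As
normalizers grow in finite `2`-groups, there are `a ∈ A \ D` and `b ∈ B \ D` which normalize `D` and
are involutions modulo `D`. Two involutions generate a dihedral group, which is finite in a torsion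
group; hence `D`, `a` and `b` generate a finite group (`exists_finite_of_sq_mem`). A maximal finite
subgroup `C` containing it meets both `A` and `B` in more than `D`, so `A = C = B`, a contradiction.
Thus there is a single maximal finite subgroup. It contains every finite cyclic subgroup, so it is
all of `G`.
-/

/-! ### Finite subgroups of `2`-groups -/

theorem finite_sup_of_le_normalizer {G : Type*} [Group G] {H K : Subgroup G} [Finite H] [Finite K]
    (h : K ≤ Subgroup.normalizer (H : Set G)) : Finite (H ⊔ K : Subgroup G) := by
  have hfin : ((H ⊔ K : Subgroup G) : Set G).Finite := by
    rw [Subgroup.coe_mul_of_right_le_normalizer_left H K h]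
    exact (Set.toFinite (H : Set G)).mul (Set.toFinite (K : Set G))
  exact hfin.to_subtype

/-- If `a` conjugates `H` into itself then so does `a⁻¹`, since `a ^ 2` lies in `H`. -/
theorem mem_normalizer_of_sq_mem {G : Type*} [Group G] {H : Subgroup G} {a : G}
    (hconj : ∀ h ∈ H, a * h * a⁻¹ ∈ H) (ha : a ^ 2 ∈ H) :
    a ∈ Subgroup.normalizer (H : Set G) := by
  rw [Subgroup.mem_normalizer_iff]
  refine fun h => ⟨hconj h, fun hh => ?_⟩
  have key := H.mul_mem (H.mul_mem (H.inv_mem ha) (hconj _ hh)) ha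
  have e : (a ^ 2)⁻¹ * (a * (a * h * a⁻¹) * a⁻¹) * a ^ 2 = h := by group
  rwa [e] at key

/-- A subgroup `D` together with two elements that are involutions modulo `D` generates a finite
group, provided `D` is finite and the ambient group is torsion: modulo `D` the group is dihedral. -/
theorem exists_finite_of_sq_mem {G : Type*} [Group G] (hG : ∀ g : G, IsOfFinOrder g)
    {D : Subgroup G} [Finite D] {a b : G} (ha : a ∈ Subgroup.normalizer (D : Set G))
    (hb : b ∈ Subgroup.normalizer (D : Set G)) (ha2 : a ^ 2 ∈ D) (hb2 : b ^ 2 ∈ D) :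
    ∃ F : Subgroup G, Finite F ∧ D ≤ F ∧ a ∈ F ∧ b ∈ F := by
  have hcyc : ∀ g : G, Finite (Subgroup.zpowers g) := fun g => (hG g).finite_zpowers.to_subtype
  have := hcyc (a * b)
  have := hcyc a
  -- `E` is the rotation subgroup, which `a` normalizes.
  let E : Subgroup G := D ⊔ Subgroup.zpowers (a * b)
  have hDE : D ≤ E := le_sup_left
  have habE : a * b ∈ E := Subgroup.mem_sup_right (Subgroup.mem_zpowers _)
  have : Finite E := finite_sup_of_le_normalizer (by
    rw [Subgroup.zpowers_le]; exact Subgroup.mul_mem _ ha hb)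
  have hle : E ≤ E.comap (MulAut.conj a).toMonoidHom := by
    refine sup_le (fun d hd => ?_) ?_
    · exact hDE ((Subgroup.mem_normalizer_iff.1 ha d).1 hd)
    · rw [Subgroup.zpowers_le]
      change a * (a * b) * a⁻¹ ∈ E
      have key := E.mul_mem (E.mul_mem (hDE ha2) (hDE hb2)) (E.inv_mem habE)
      have e : a ^ 2 * b ^ 2 * (a * b)⁻¹ = a * (a * b) * a⁻¹ := by
        simp [pow_two, mul_assoc]
      rwa [e] at key
  have haE : a ∈ Subgroup.normalizer (E : Set G) :=
    mem_normalizer_of_sq_mem (fun h hh => hle hh) (hDE ha2)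
  have haF : a ∈ E ⊔ Subgroup.zpowers a := Subgroup.mem_sup_right (Subgroup.mem_zpowers a)
  refine ⟨E ⊔ Subgroup.zpowers a, finite_sup_of_le_normalizer (by rwa [Subgroup.zpowers_le]),
    hDE.trans le_sup_left, haF, ?_⟩
  have key := Subgroup.mul_mem _ (Subgroup.inv_mem _ haF)
    (Subgroup.mem_sup_left (T := Subgroup.zpowers a) habE)
  rwa [inv_mul_cancel_left] at key

/-- Normalizers grow in finite `p`-groups: the quotient of the normalizer of `D` in `A` by `D` is a
nontrivial `p`-group, so it contains an element of order `p`, which the lemma lifts to `A`. -/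
theorem exists_mem_normalizer_pow_mem {G : Type*} [Group G] {p : ℕ} [Fact p.Prime]
    (hG : IsPGroup p G) {A D : Subgroup G} [Finite A] (hDA : D < A) :
    ∃ a ∈ A, a ∉ D ∧ a ∈ Subgroup.normalizer (D : Set G) ∧ a ^ p ∈ D := by
  classical
  have hnil : Group.IsNilpotent A := (hG.to_subgroup A).isNilpotent
  have hlt : D.subgroupOf A < ⊤ := by
    rw [lt_top_iff_ne_top, Ne, Subgroup.subgroupOf_eq_top]
    exact not_le_of_gt hDA
  obtain ⟨-, g, hgN, hgD⟩ := SetLike.lt_iff_le_and_exists.1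
    (Group.normalizerCondition_of_isNilpotent (D.subgroupOf A) hlt)
  have hgN' : (g : G) ∈ Subgroup.normalizer (D : Set G) := by
    rw [Subgroup.mem_normalizer_iff] at hgN ⊢
    refine fun h => ⟨fun hh => (hgN ⟨h, hDA.le hh⟩).1 hh, fun hh => ?_⟩
    have hA : h ∈ A := by
      have key := A.mul_mem (A.mul_mem (A.inv_mem g.2) (hDA.le hh)) g.2
      have e : (g : G)⁻¹ * (g * h * (g : G)⁻¹) * g = h := by group
      rwa [e] at key
    exact (hgN ⟨h, hA⟩).2 hh
  -- The last `p`-power of `g` outside `D` is the element sought.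
  have hex : ∃ n, (g : G) ^ p ^ n ∈ D := by
    obtain ⟨n, hn⟩ := hG (g : G)
    exact ⟨n, hn ▸ D.one_mem⟩
  obtain ⟨n, hn⟩ : ∃ n, Nat.find hex = n + 1 := by
    refine Nat.exists_eq_succ_of_ne_zero fun h0 => hgD ?_
    have := Nat.find_spec hex
    rw [h0, pow_zero, pow_one] at this
    exact this
  refine ⟨(g : G) ^ p ^ n, A.pow_mem g.2 _, Nat.find_min hex (by omega),
    Subgroup.pow_mem _ hgN' _, ?_⟩
  have := Nat.find_spec hex
  rwa [hn, pow_succ, pow_mul] at this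

/-! ### Maximal finite subgroups under the ascending chain condition -/

theorem exists_le_maximal_finite {G : Type*} [Group G] [WellFoundedGT (Subgroup G)]
    (F : Subgroup G) [hF : Finite F] :
    ∃ M : Subgroup G, F ≤ M ∧ Maximal (fun H : Subgroup G => Finite H) M :=
  exists_maximal_ge_of_wellFoundedGT (fun H : Subgroup G => Finite H) F hF

/-- Two distinct maximal finite subgroups with intersection as large as possible would both equal a
maximal finite subgroup containing one element of each that is an involution modulo the
intersection. -/
theorem Maximal.eq_of_isPGroup_two {G : Type*} [Group G] [WellFoundedGT (Subgroup G)]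
    (hG : IsPGroup 2 G) {A B : Subgroup G} (hA : Maximal (fun H : Subgroup G => Finite H) A)
    (hB : Maximal (fun H : Subgroup G => Finite H) B) : A = B := by
  by_contra hne
  -- Among all pairs of distinct maximal finite subgroups, pick one with maximal intersection.
  let S : Set (Subgroup G) := {D | ∃ A B : Subgroup G,
    Maximal (fun H : Subgroup G => Finite H) A ∧ Maximal (fun H : Subgroup G => Finite H) B ∧
      A ≠ B ∧ A ⊓ B = D}
  obtain ⟨D, ⟨A, B, hA, hB, hne, rfl⟩, hmax⟩ :=
    (wellFounded_gt (α := Subgroup G)).has_min S ⟨_, A, B, hA, hB, hne, rfl⟩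
  have : Finite A := hA.prop
  have : Finite B := hB.prop
  have hltA : A ⊓ B < A := inf_lt_left.2 fun h => hne (hA.eq_of_le hB.prop h)
  have hltB : A ⊓ B < B := inf_lt_right.2 fun h => hne (hB.eq_of_le hA.prop h).symm
  have : Finite (A ⊓ B : Subgroup G) := Finite.of_injective _ (Subgroup.inclusion_injective hltA.le)
  obtain ⟨a, haA, haD, haN, ha2⟩ := exists_mem_normalizer_pow_mem hG hltA
  obtain ⟨b, hbB, hbD, hbN, hb2⟩ := exists_mem_normalizer_pow_mem hG hltB
  obtain ⟨F, hF, hDF, haF, hbF⟩ :=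
    exists_finite_of_sq_mem (hG.isOfFinOrder two_ne_zero) haN hbN ha2 hb2
  obtain ⟨C, hFC, hC⟩ := exists_le_maximal_finite F
  have hAC : A = C := by
    by_contra h
    refine hmax (A ⊓ C) ⟨A, C, hA, hC, h, rfl⟩ ?_
    have hle : A ⊓ B ≤ A ⊓ C := le_inf inf_le_left (hDF.trans hFC)
    exact hle.lt_of_not_ge fun h' => haD (h' ⟨haA, hFC haF⟩)
  have hBC : B = C := by
    by_contra h
    refine hmax (B ⊓ C) ⟨B, C, hB, hC, h, rfl⟩ ?_
    have hle : A ⊓ B ≤ B ⊓ C := le_inf inf_le_right (hDF.trans hFC)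
    exact hle.lt_of_not_ge fun h' => hbD (h' ⟨hbB, hFC hbF⟩)
  exact hne (hAC.trans hBC.symm)

theorem finite_of_isPGroup_two_of_wellFoundedGT {G : Type*} [Group G] [WellFoundedGT (Subgroup G)]
    (hG : IsPGroup 2 G) : Finite G := by
  obtain ⟨M, -, hM⟩ := exists_le_maximal_finite (⊥ : Subgroup G)
  have htop : M = ⊤ := by
    refine (Subgroup.eq_top_iff' M).2 fun g => ?_
    have : Finite (Subgroup.zpowers g) := (hG.isOfFinOrder two_ne_zero g).finite_zpowers.to_subtype
    obtain ⟨C, hgC, hC⟩ := exists_le_maximal_finite (Subgroup.zpowers g)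
    rw [hM.eq_of_isPGroup_two hG hC]
    exact hgC (Subgroup.mem_zpowers g)
  have : Finite (⊤ : Subgroup G) := htop ▸ hM.prop
  exact Finite.of_equiv _ (Subgroup.topEquiv (G := G)).toEquiv

/-! ### Subgroups and left ideals of the group algebra -/

/-- The left ideal of `k[G]` generated by the elements `h - 1` for `h` in the subgroup `H`. -/
noncomputable def subgroupIdeal (k : Type*) {G : Type*} [Ring k] [Group G] (H : Subgroup G) :
    Ideal (MonoidAlgebra k G) :=
  Ideal.span ((fun h => MonoidAlgebra.of k G h - 1) '' (H : Set G))

theorem of_sub_one_mem_subgroupIdeal_iff {k G : Type*} [CommRing k] [Nontrivial k] [Group G]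
    {H : Subgroup G} {g : G} : MonoidAlgebra.of k G g - 1 ∈ subgroupIdeal k H ↔ g ∈ H := by
  refine ⟨fun hg => ?_, fun hg => Ideal.subset_span ⟨g, hg, rfl⟩⟩
  -- The ideal annihilates the base point `v` of the permutation module on `G ⧸ H`.
  let ρ := Representation.ofMulAction k G (G ⧸ H)
  let v : MonoidAlgebra k (G ⧸ H) := MonoidAlgebra.single ((1 : G) : G ⧸ H) 1
  have hann : ∀ x ∈ subgroupIdeal k H, ρ.asAlgebraHom x v = 0 := by
    intro x hx
    induction hx using Submodule.span_induction with
    | mem x hx =>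
      obtain ⟨h, hh, rfl⟩ := hx
      have e : h • ((1 : G) : G ⧸ H) = ((1 : G) : G ⧸ H) := by
        rw [MulAction.Quotient.smul_coe, QuotientGroup.eq]
        simpa using hh
      simp [ρ, v, e]
    | zero => simp
    | add x y _ _ hx hy => simp [hx, hy]
    | smul a x _ hx => simp [hx]
  have h0 := hann _ hg
  have h1 : MonoidAlgebra.single (g • ((1 : G) : G ⧸ H)) (1 : k) =
      MonoidAlgebra.single ((1 : G) : G ⧸ H) 1 := by
    simpa [ρ, v, sub_eq_zero] using h0
  have h2 := MonoidAlgebra.single_left_injective (one_ne_zero (α := k)) h1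
  rw [MulAction.Quotient.smul_coe, QuotientGroup.eq] at h2
  simpa using h2

theorem wellFoundedGT_subgroup_of_isNoetherianRing (k G : Type*) [CommRing k] [Nontrivial k]
    [Group G] [IsNoetherianRing (MonoidAlgebra k G)] : WellFoundedGT (Subgroup G) := by
  have hmono : StrictMono (subgroupIdeal k (G := G)) := by
    intro H K hHK
    refine lt_of_le_not_ge (Ideal.span_mono (Set.image_mono hHK.le)) fun hle => hHK.not_ge ?_
    exact fun g hg => of_sub_one_mem_subgroupIdeal_iff.1
      (hle (of_sub_one_mem_subgroupIdeal_iff.2 hg))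
  exact hmono.wellFoundedGT

theorem mainTheorem8 {G : Type*} [Group G] (hG : IsPGroup 2 G)
    {k : Type*} [Field k] [CharP k 2] (hk : IsNoetherianRing (MonoidAlgebra k G)) :
    Finite G := by
  have := wellFoundedGT_subgroup_of_isNoetherianRing k G
  exact finite_of_isPGroup_two_of_wellFoundedGT hG
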